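/- Notation. For a string $T=T[0..n-1]$ over $[0..\sigma-1]$, $T[f..]$ denotes the suffix starting at position $f$ (the empty string if $f\ge n$), and $|LCP(X,Y)|$ is the length of the longest common prefix of $X$ and $Y$. For an integer $r\ge 1$ let $s=12r^2+18r+6$, and let $a_0=0$, $a_j=a_{j-1}+b_j$ for $1\le j\le 6r+3$, where $b_j=1$ for $1\le j\le r$, $b_{r+1}=r+1$, $b_j=2r+1$ for $r+2\le j\le 2r+1$, $b_j=4r+3$ for $2r+2\le j\le 4r+2$, $b_j=2r+2$ for $4r+3\le j\le 5r+3$, and $b_j=1$ for $5r+4\le j\le 6r+3$. If $s$ divides $n$, the selected positions of $T$ are the numbers $sq+a_j$ with $0\le q<n/s$ and $0\le j\le 6r+3$; let $\mathcal S'$ be the set of suffixes of $T$ that start at selected positions. Model. A word RAM with $w$-bit words has registers and a fixed number of memory arrays indexed by words. Reading or writing an array entry, loading a constant, a conditional jump, and an arithmetic ($+,-,\times,\div,\bmod$), bitwise, shift or comparison operation on words take one unit of time each. Programs are finite and do not depend on the input or on $w$. Lemma. Let $0<c_1\le c_2$ and $\kappa>0$ be constants. There are a word-RAM program and constants $c$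 and $C$, depending only on $c_1,c_2,\kappa$, such that the following holds. Let $2\le\sigma\le n$, let $r$ be an integer with $c_1\sqrt{\log_\sigma n}\le r\le c_2\sqrt{\log_\sigma n}$ such that $s=12r^2+18r+6$ divides $n$, and let the word length $w$ satisfy $n<2^w$ and $w\le\kappa\log_2 n$. Then for every text $T[0..n-1]$ over $[0..\sigma-1]$ there is a data structure of at most $C\,n\sqrt{\log_2 n\,\log_2\sigma}$ bits, stored in the memory arrays, with which the program answers every query of the following kind in at most $c$ steps, leaving the memory unchanged: given positions $f_1,f_2$ such that $S_1=T[f_1..]$ and $S_2=T[f_2..]$ are in $\mathcal S'$ (that is, $f_1,f_2$ are selected positions) and an integer $i$ with $1\le i\le 4r+3$, return $|LCP(T[f_1+i..],S_2)|$. -/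

import Mathlib

/-! ### Strings -/

/-- The longest common prefix of two strings. -/
def lcp {α : Type*} [DecidableEq α] : List α → List α → List α
  | x :: xs, y :: ys => if x = y then x :: lcp xs ys else []
  | _, _ => []

theorem lcp_prefix {α : Type*} [DecidableEq α] :
    ∀ X Y : List α, lcp X Y <+: X ∧ lcp X Y <+: Y
  | [], _ => by simp [lcp]
  | _ :: _, [] => by simp [lcp]
  | x :: xs, y :: ys => by
      have ih := lcp_prefix xs ys
      by_cases h : x = y
      · subst h
        simpa [lcp, List.cons_prefix_cons] using ih
      · simp [lcp, h]

theorem prefix_lcp {α : Type*} [DecidableEq α] :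
    ∀ P X Y : List α, P <+: X → P <+: Y → P <+: lcp X Y
  | [], _, _, _, _ => List.nil_prefix
  | p :: ps, [], _, h, _ => by simp at h
  | p :: ps, _ :: _, [], _, h => by simp at h
  | p :: ps, x :: xs, y :: ys, h₁, h₂ => by
      rw [List.cons_prefix_cons] at h₁ h₂
      obtain ⟨rfl, h₁⟩ := h₁
      obtain ⟨rfl, h₂⟩ := h₂
      simpa [lcp, List.cons_prefix_cons] using prefix_lcp ps xs ys h₁ h₂

/-- The suffix `T[f..]` of `T` (empty when `f` is at least the length of `T`). -/
def suffixFrom {α : Type*} (T : List α) (f : ℕ) : List α := T.drop f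

/-! ### Difference-cover sampling -/

/-- The gaps `b_1, …, b_{6r+3}` of the difference cover. -/
def coverGap (r i : ℕ) : ℕ :=
  if i ≤ r then 1
  else if i = r + 1 then r + 1
  else if i ≤ 2 * r + 1 then 2 * r + 1
  else if i ≤ 4 * r + 2 then 4 * r + 3
  else if i ≤ 5 * r + 3 then 2 * r + 2
  else 1

/-- The elements `a_0 = 0`, `a_i = a_{i-1} + b_i` of the difference cover, for `0 ≤ i ≤ 6r+3`. -/
def coverMark (r : ℕ) : ℕ → ℕ
  | 0 => 0
  | i + 1 => coverMark r i + coverGap r (i + 1)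

/-- The block length, which is also the modulus of the difference cover. -/
def blockLength (r : ℕ) : ℕ := 12 * r ^ 2 + 18 * r + 6

/-- `f` is a selected position of a text of length `n`. -/
def IsSelected (n r f : ℕ) : Prop :=
  ∃ q j : ℕ, q < n / blockLength r ∧ j ≤ 6 * r + 3 ∧ f = blockLength r * q + coverMark r j

/-! ### The word RAM with `w`-bit words -/

namespace WordRAM

/-- Arithmetic, bitwise and comparison operations on words. -/
inductive Op where
  | add | sub | mul | div | mod | and | or | xor | shl | shr | eq | lt

/-- Value of an operation: arithmetic is unsigned modulo `2 ^ w`, a comparison gives `0` or `1`. -/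
def Op.eval {w : ℕ} : Op → BitVec w → BitVec w → BitVec w
  | .add, x, y => x + y
  | .sub, x, y => x - y
  | .mul, x, y => x * y
  | .div, x, y => x / y
  | .mod, x, y => x % y
  | .and, x, y => x &&& y
  | .or, x, y => x ||| y
  | .xor, x, y => x ^^^ y
  | .shl, x, y => x <<< y
  | .shr, x, y => x >>> y
  | .eq, x, y => if x = y then 1 else 0
  | .lt, x, y => if x.toNat < y.toNat then 1 else 0

/-- Instructions; each of them takes one unit of time. Registers, memory arrays and program
addresses occur in a program as literal numbers. -/
inductive Instr where
  /-- `R[d] := c mod 2 ^ w` -/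
  | const (d c : ℕ)
  /-- `R[d] := R[a] o R[b]` -/
  | op (o : Op) (d a b : ℕ)
  /-- `R[d] := M_m[R[a]]` -/
  | load (d m a : ℕ)
  /-- `M_m[R[a]] := R[b]` -/
  | store (m a b : ℕ)
  /-- continue at program address `l` if `R[a] ≠ 0` -/
  | jnz (a l : ℕ)

/-- A program is a finite list of instructions; it does not depend on the word length. -/
abbrev Program := List Instr

/-- A configuration: program counter, registers, and arrays `M_0, M_1, …` indexed by words. -/
structure State (w : ℕ) where
  pc : ℕ
  reg : ℕ → BitVec w
  mem : ℕ → BitVec w → BitVec w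

/-- Execution of one instruction. -/
def Instr.exec {w : ℕ} : Instr → State w → State w
  | .const d c, S =>
      { S with pc := S.pc + 1, reg := Function.update S.reg d (BitVec.ofNat w c) }
  | .op o d a b, S =>
      { S with pc := S.pc + 1, reg := Function.update S.reg d (o.eval (S.reg a) (S.reg b)) }
  | .load d m a, S =>
      { S with pc := S.pc + 1, reg := Function.update S.reg d (S.mem m (S.reg a)) }
  | .store m a b, S =>
      { S with
        pc := S.pc + 1
        mem := Function.update S.mem m (Function.update (S.mem m) (S.reg a) (S.reg b)) }
  | .jnz a l, S => { S with pc := if S.reg a = 0 then S.pc + 1 else l }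

/-- The machine has halted when the program counter is outside the program. -/
def Halted {w : ℕ} (P : Program) (S : State w) : Prop := P.length ≤ S.pc

/-- One step of the machine (a halted machine does not move). -/
def step {w : ℕ} (P : Program) (S : State w) : State w :=
  match P[S.pc]? with
  | some I => I.exec S
  | none => S

/-- The memory that holds the lists `D_0, …, D_{k-1}` in its first `k` arrays, and zeros
everywhere else. -/
def memOf {w k : ℕ} (D : Fin k → List (BitVec w)) : ℕ → BitVec w → BitVec w :=
  fun m x => if h : m < k then (D ⟨m, h⟩).getD x.toNat 0 else 0

/-- Start configuration: the given arguments are in the registers `0, 1, 2, …`. -/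
def start {w : ℕ} (M : ℕ → BitVec w → BitVec w) (args : List (BitVec w)) : State w where
  pc := 0
  reg := fun j => args.getD j 0
  mem := M

/-- Started on memory `M` with the arguments `args`, the program `P` halts after at most `c`
steps with the number `out` in register `0`, and with the memory as it was at the start. -/
def ComputesWithin {w : ℕ} (P : Program) (M : ℕ → BitVec w → BitVec w)
    (args : List (BitVec w)) (out c : ℕ) : Prop :=
  ∃ t ≤ c, Halted P ((step P)^[t] (start M args)) ∧
    (((step P)^[t] (start M args)).reg 0).toNat = out ∧
    ((step P)^[t] (start M args)).mem = M

end WordRAM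

/-! The structure answers LCP queries for arbitrary positions at most `n`; selected positions are
such positions by `IsSelected.le`. Take `m` of order `√(log n / log σ)`, rounded so that `m ≥ 1`,
and put `h = 2(m² - 1)`. A position is sampled if it is a multiple of `m` or has residue below `m`
modulo `m²`, which gives `O(n/m)` samples. By `exists_shift`, any two positions `p`, `q` have a
common shift `δ ≤ h` that makes `p + δ` a multiple of `m` and `q + δ` a position with small residue.
A query compares the first `h` characters by one lookup in a table of pairs of short windows. A
mismatch there gives the answer. Otherwise it moves both positions by `δ` and adds the LCP of two
sampled suffixes. In sorted order this LCP is a range minimum (`length_lcp_eq_min`). It is found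
with blocks of length `b ≈ (log n)/8`: bit masks within a block (`query_within_block`), and a sparse
table over block boundaries between blocks (`eq_min_of_blocks`). All arrays together have `O(n/m)`
words of `O(log n)` bits, hence `O(n √(log n · log σ))` bits. Texts shorter than a constant `n₀` get
a table of all answers. The program is compiled from a fixed expression without jumps, so its length
bounds the time; `den_posLcp` proves the expression correct. -/

/-! ### Straight-line programs from expressions -/

namespace WordRAM

/-- Expressions over three arguments. -/
inductive Expr where
  | arg (j : Fin 3)
  | const (c : ℕ)
  | op (o : Op) (a b : Expr)
  | load (m : ℕ) (a : Expr)

namespace Expr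

/-- Value of an expression. -/
def eval {w : ℕ} (M : ℕ → BitVec w → BitVec w) (args : List (BitVec w)) : Expr → BitVec w
  | arg j => args.getD j 0
  | const c => BitVec.ofNat w c
  | op o a b => o.eval (a.eval M args) (b.eval M args)
  | load m a => M m (a.eval M args)

/-- Code that puts the value of an expression into register `d` and does not change the
registers before `d`. -/
def code : Expr → ℕ → Program
  -- There is no move instruction; `or` of a register with itself is a copy.
  | arg j, d => [.op .or d j j]
  | const c, d => [.const d c]
  | op o a b, d => a.code d ++ b.code (d + 1) ++ [.op o d d (d + 1)]
  | load m a, d => a.code d ++ [.load d m d]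

/-- The program that computes an expression. -/
def program (e : Expr) : Program := e.code 3 ++ [.op .or 0 3 3]

end Expr

/-- The instruction is not a jump. -/
def Instr.IsStraight : Instr → Prop
  | .jnz _ _ => False
  | _ => True

theorem Instr.IsStraight.pc_exec {w : ℕ} {I : Instr} (h : I.IsStraight) (S : State w) :
    (I.exec S).pc = S.pc + 1 := by
  cases I <;> simp_all [Instr.IsStraight, Instr.exec]

/-- Consecutive execution of a list of instructions. -/
def execList {w : ℕ} (Q : List Instr) (S : State w) : State w := Q.foldl (fun S I => I.exec S) S

theorem execList_append {w : ℕ} (Q R : List Instr) (S : State w) :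
    execList (Q ++ R) S = execList R (execList Q S) := by
  simp [execList]

theorem execList_singleton {w : ℕ} (I : Instr) (S : State w) : execList [I] S = I.exec S := rfl

/-- Induction on the part `R` still to be executed; `Q` is the part already passed, so its length is
the program counter. -/
theorem iterate_step_eq_execList {w : ℕ} (P : Program) :
    ∀ (R Q : List Instr) (S : State w), P = Q ++ R → (∀ I ∈ R, I.IsStraight) →
      S.pc = Q.length →
      (step P)^[R.length] S = execList R S ∧ (execList R S).pc = P.length
  | [], Q, S, hP, _, hS => by simp [execList, hP, hS]
  | I :: R, Q, S, hP, hR, hS => by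
    have h1 : step P S = I.exec S := by
      simp [step, hP, hS]
    have := iterate_step_eq_execList P R (Q ++ [I]) (I.exec S) (by simp [hP])
      (fun J hJ => hR J (by simp [hJ]))
      (by rw [(hR I (by simp)).pc_exec, hS]; simp)
    simpa [h1, execList] using this

namespace Expr

theorem isStraight_code : ∀ (e : Expr) (d : ℕ), ∀ I ∈ e.code d, I.IsStraight
  | arg j, d, I, h => by simp [code] at h; simp [h, Instr.IsStraight]
  | const c, d, I, h => by simp [code] at h; simp [h, Instr.IsStraight]
  | op o a b, d, I, h => by
    simp only [code, List.mem_append, List.mem_singleton] at h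
    rcases h with (h | h) | h
    · exact isStraight_code a _ _ h
    · exact isStraight_code b _ _ h
    · simp [h, Instr.IsStraight]
  | load m a, d, I, h => by
    simp only [code, List.mem_append, List.mem_singleton] at h
    rcases h with h | h
    · exact isStraight_code a _ _ h
    · simp [h, Instr.IsStraight]

/-- The registers from `d` on serve as a stack: the second operand is computed at `d + 1` and spares
the first. Registers 0 to 2 lie below the stack and keep the arguments. -/
theorem execList_code {w : ℕ} (args : List (BitVec w)) :
    ∀ (e : Expr) (d : ℕ) (S : State w), 3 ≤ d → (∀ j < 3, S.reg j = args.getD j 0) →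
      (execList (e.code d) S).mem = S.mem ∧
      (∀ j < d, (execList (e.code d) S).reg j = S.reg j) ∧
      (execList (e.code d) S).reg d = e.eval S.mem args
  | arg j, d, S, hd, hS => by
    have h3 : (j : ℕ) < 3 := j.2
    refine ⟨rfl, fun i hi => ?_, ?_⟩
    · simp [code, execList, Instr.exec, Function.update_of_ne hi.ne]
    · simp [code, execList, Instr.exec, Op.eval, eval, hS _ h3]
  | const c, d, S, hd, hS => by
    refine ⟨rfl, fun i hi => ?_, ?_⟩
    · simp [code, execList, Instr.exec, Function.update_of_ne hi.ne]
    · simp [code, execList, Instr.exec, eval]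
  | op o a b, d, S, hd, hS => by
    obtain ⟨m1, r1, v1⟩ := execList_code args a d S hd hS
    obtain ⟨m2, r2, v2⟩ := execList_code args b (d + 1) (execList (a.code d) S) (by omega)
      (fun j hj => by rw [r1 j (by omega), hS j hj])
    simp only [code, execList_append, execList_singleton, Instr.exec]
    refine ⟨m2.trans m1, fun i hi => ?_, ?_⟩
    · rw [Function.update_of_ne hi.ne, r2 i (by omega), r1 i hi]
    · rw [Function.update_self, v2, r2 d (by omega), v1, m1, eval]
  | load m a, d, S, hd, hS => by
    obtain ⟨m1, r1, v1⟩ := execList_code args a d S hd hS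
    simp only [code, execList_append, execList_singleton, Instr.exec]
    refine ⟨m1, fun i hi => ?_, ?_⟩
    · rw [Function.update_of_ne hi.ne, r1 i hi]
    · rw [Function.update_self, v1, m1, eval]

/-- The expression `e` has the value `a` modulo `2 ^ w`. -/
def Den {w : ℕ} (M : ℕ → BitVec w → BitVec w) (args : List (BitVec w)) (e : Expr) (a : ℕ) :
    Prop :=
  e.eval M args = BitVec.ofNat w a

theorem computesWithin_program {w : ℕ} {M : ℕ → BitVec w → BitVec w} {args : List (BitVec w)}
    {e : Expr} {a : ℕ} (h : Den M args e a) (ha : a < 2 ^ w) :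
    ComputesWithin e.program M args a e.program.length := by
  have hs : ∀ I ∈ e.program, I.IsStraight := by
    intro I hI
    simp only [program, List.mem_append, List.mem_singleton] at hI
    rcases hI with hI | hI
    · exact isStraight_code _ _ _ hI
    · simp [hI, Instr.IsStraight]
  obtain ⟨h1, h2⟩ := iterate_step_eq_execList e.program e.program [] (start M args) (by simp) hs rfl
  obtain ⟨m1, -, v1⟩ := execList_code args e 3 (start M args) le_rfl (fun j _ => rfl)
  have h3 : (start M args).mem = M := rfl
  rw [h3] at m1 v1
  refine ⟨e.program.length, le_rfl, ?_, ?_, ?_⟩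
  · rw [h1]; exact h2.ge
  · rw [h1, program, execList_append]
    simp only [execList, List.foldl_cons, List.foldl_nil, Instr.exec] at v1 ⊢
    rw [Function.update_self, v1, h]
    simp [Op.eval, Nat.mod_eq_of_lt ha]
  · rw [h1, program, execList_append]
    simp only [execList, List.foldl_cons, List.foldl_nil, Instr.exec] at m1 ⊢
    exact m1

/-! ### Values of expressions modulo `2 ^ w` -/

section Den

variable {w : ℕ} {M : ℕ → BitVec w → BitVec w} {args : List (BitVec w)} {e f g : Expr} {a b : ℕ}

theorem Den.const (c : ℕ) : Den M args (const c) c := rfl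

theorem Den.add (he : Den M args e a) (hf : Den M args f b) :
    Den M args (op .add e f) (a + b) := by
  rw [Den, eval, he, hf, Op.eval, BitVec.ofNat_add]

theorem Den.mul (he : Den M args e a) (hf : Den M args f b) :
    Den M args (op .mul e f) (a * b) := by
  rw [Den, eval, he, hf, Op.eval, BitVec.ofNat_mul]

theorem Den.sub (he : Den M args e a) (hf : Den M args f b) (h : b ≤ a) :
    Den M args (op .sub e f) (a - b) := by
  rw [Den, eval, he, hf, Op.eval, sub_eq_iff_eq_add, ← BitVec.ofNat_add, Nat.sub_add_cancel h]

theorem Den.div (he : Den M args e a) (hf : Den M args f b) (ha : a < 2 ^ w) (hb : b < 2 ^ w) :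
    Den M args (op .div e f) (a / b) := by
  rw [Den, eval, he, hf, Op.eval]
  apply BitVec.eq_of_toNat_eq
  have h : a / b < 2 ^ w := (Nat.div_le_self a b).trans_lt ha
  simp [Nat.mod_eq_of_lt, ha, hb, h]

theorem Den.mod (he : Den M args e a) (hf : Den M args f b) (ha : a < 2 ^ w) (hb : b < 2 ^ w) :
    Den M args (op .mod e f) (a % b) := by
  rw [Den, eval, he, hf, Op.eval]
  apply BitVec.eq_of_toNat_eq
  have h : a % b < 2 ^ w := (Nat.mod_le a b).trans_lt ha
  simp [Nat.mod_eq_of_lt, ha, hb, h]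

/-- Selection: `f` if `e` is `1`, and `g` if `e` is `0`. -/
def sel (e f g : Expr) : Expr := op .add g (op .mul e (op .sub f g))

/-- Both branches are evaluated, but the rejected one cancels modulo `2 ^ w`. It may therefore be
meaningless, such as a read outside the intended range. -/
theorem Den.sel_one (he : Den M args e 1) (hf : Den M args f a) : Den M args (sel e f g) a := by
  simp only [Den, sel, eval, Op.eval] at he hf ⊢
  rw [he, hf]
  simp

theorem Den.sel_zero (he : Den M args e 0) (hg : Den M args g a) :
    Den M args (sel e f g) a := by
  simp only [Den, sel, eval, Op.eval] at he hg ⊢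
  rw [he, hg]
  simp

theorem Den.sel_eq {e' : Expr} {x y : ℕ} (he : Den M args e x) (he' : Den M args e' y)
    (hx : x < 2 ^ w) (hy : y < 2 ^ w) (hf : x = y → Den M args f a)
    (hg : x ≠ y → Den M args g a) : Den M args (sel (op .eq e e') f g) a := by
  by_cases h : x = y
  · refine Den.sel_one ?_ (hf h)
    rw [Den, eval, he, he', h]; simp [Op.eval]
  · refine Den.sel_zero ?_ (hg h)
    rw [Den, eval, he, he', Op.eval, if_neg]
    · simp
    · intro h'
      have := congrArg BitVec.toNat h'
      simp [Nat.mod_eq_of_lt, hx, hy] at this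
      exact h this

theorem Den.sel_lt {e' : Expr} {x y : ℕ} (he : Den M args e x) (he' : Den M args e' y)
    (hx : x < 2 ^ w) (hy : y < 2 ^ w) (hf : x < y → Den M args f a)
    (hg : ¬ x < y → Den M args g a) : Den M args (sel (op .lt e e') f g) a := by
  have h0 : (op .lt e e').eval M args = if x < y then 1 else 0 := by
    rw [eval, he, he', Op.eval]
    simp [Nat.mod_eq_of_lt, hx, hy]
  by_cases h : x < y
  · refine Den.sel_one ?_ (hf h)
    rw [Den, h0]; simp [h]
  · refine Den.sel_zero ?_ (hg h)
    rw [Den, h0]; simp [h]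

/-- Minimum of two expressions. -/
protected def min (e f : Expr) : Expr := sel (op .lt e f) e f

protected theorem Den.min (he : Den M args e a) (hf : Den M args f b) (ha : a < 2 ^ w) (hb : b < 2 ^ w) :
    Den M args (e.min f) (min a b) := by
  refine Den.sel_lt he hf ha hb (fun h => ?_) (fun h => ?_)
  · rwa [min_eq_left h.le]
  · rwa [min_eq_right (not_lt.1 h)]

/-- The array `m` holds the numbers `F 0, …, F (len - 1)`. -/
def Holds {w : ℕ} (M : ℕ → BitVec w → BitVec w) (m len : ℕ) (F : ℕ → ℕ) : Prop :=
  ∀ a < len, M m (BitVec.ofNat w a) = BitVec.ofNat w (F a)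

theorem Den.load {m len : ℕ} {F : ℕ → ℕ} (hM : Holds M m len F) (he : Den M args e a)
    (ha : a < len) : Den M args (load m e) (F a) := by
  rw [Den, eval, he, hM a ha]

/-- The entry with the index `a` of the array with the number `m + t`, for `j ≤ t < j + K`. -/
def loadFrom (m : ℕ) (t a : Expr) : ℕ → ℕ → Expr
  | _, 0 => const 0
  | j, K + 1 => sel (op .eq t (const j)) (load (m + j) a) (loadFrom m t a (j + 1) K)

/-- Array numbers are literals of instructions, so a computed array number has to be resolved by
comparisons. Their number `K` is a constant of the program. -/
theorem Den.loadFrom {m len t : ℕ} {F : ℕ → ℕ} (hM : Holds M (m + t) len F)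
    (he : Den M args e t) (ht : t < 2 ^ w) (hf : Den M args f a) (ha : a < len) :
    ∀ (K j : ℕ), j ≤ t → t < j + K → Den M args (Expr.loadFrom m e f j K) (F a)
  | 0, j, h1, h2 => by omega
  | K + 1, j, h1, h2 => by
    refine Den.sel_eq he (Den.const j) ht (h1.trans_lt ht) (fun h => ?_) (fun h => ?_)
    · subst h; exact Den.load hM hf ha
    · exact Den.loadFrom hM he ht hf ha K (j + 1) (by omega) (by omega)

end Den

end Expr

theorem holds_memOf {w k m : ℕ} (len : ℕ → ℕ) (F : ℕ → ℕ → ℕ) (hm : m < k)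
    (hlen : len m ≤ 2 ^ w) :
    Expr.Holds (memOf fun i : Fin k => (List.range (len i)).map fun a => BitVec.ofNat w (F i a))
      m (len m) (F m) := by
  intro a ha
  have h : a % 2 ^ w = a := Nat.mod_eq_of_lt (ha.trans_le hlen)
  simp [memOf, hm, h, List.getD_eq_getElem?_getD, List.getElem?_range ha]

end WordRAM

/-! ### Longest common prefixes -/

theorem cons_le_cons_iff_lex {α : Type*} [LinearOrder α] {a b : α} {x y : List α} :
    a :: x ≤ b :: y ↔ a < b ∨ a = b ∧ x ≤ y := by
  rw [← not_lt, ← not_lt (a := y)]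
  constructor
  · intro h
    rcases lt_trichotomy a b with hab | rfl | hab
    · exact .inl hab
    · exact .inr ⟨rfl, fun hyx => h (List.Lex.cons hyx)⟩
    · exact absurd (List.Lex.rel hab) h
  · rintro (h | ⟨rfl, h⟩) h'
    · cases h' with
      | cons _ => exact lt_irrefl _ h
      | rel h2 => exact lt_asymm h h2
    · cases h' with
      | cons h2 => exact h h2
      | rel h2 => exact lt_irrefl _ h2

section LCP

variable {α : Type*} [DecidableEq α]

theorem lcp_self : ∀ x : List α, lcp x x = x
  | [] => rfl
  | a :: x => by simp [lcp, lcp_self x]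

theorem lcp_comm : ∀ x y : List α, lcp x y = lcp y x
  | [], [] => rfl
  | [], _ :: _ => rfl
  | _ :: _, [] => rfl
  | a :: x, b :: y => by
    by_cases h : a = b
    · subst h; simp [lcp, lcp_comm x y]
    · simp [lcp, h, Ne.symm h]

theorem length_lcp_le_left (x y : List α) : (lcp x y).length ≤ x.length :=
  (lcp_prefix x y).1.length_le

theorem length_lcp_take : ∀ (h : ℕ) (x y : List α),
    (lcp (x.take h) (y.take h)).length = min h (lcp x y).length
  | 0, x, y => by simp [lcp]
  | h + 1, [], y => by simp [lcp]
  | h + 1, _ :: _, [] => by simp [lcp]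
  | h + 1, a :: x, b :: y => by
    by_cases hab : a = b
    · subst hab
      have := length_lcp_take h x y
      simp [lcp, this]
    · simp [lcp, hab]

theorem length_lcp_drop : ∀ (δ : ℕ) (x y : List α), δ ≤ (lcp x y).length →
    (lcp x y).length = δ + (lcp (x.drop δ) (y.drop δ)).length
  | 0, x, y, _ => by simp
  | δ + 1, [], y, h => by simp [lcp] at h
  | δ + 1, _ :: _, [], h => by simp [lcp] at h
  | δ + 1, a :: x, b :: y, h => by
    by_cases hab : a = b
    · subst hab
      simp only [lcp, if_true, List.length_cons] at h ⊢
      rw [length_lcp_drop δ x y (by omega), List.drop_succ_cons, List.drop_succ_cons]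
      omega
    · simp [lcp, hab] at h

/-- A string between `x` and `z` in lexicographic order shares every common prefix of theirs. This
turns LCPs in a sorted list into range minima. -/
theorem length_lcp_eq_min [LinearOrder α] : ∀ x y z : List α, x ≤ y → y ≤ z →
    (lcp x z).length = min (lcp x y).length (lcp y z).length
  | [], y, z, _, _ => by simp [lcp]
  | a :: x, [], z, h, _ => absurd h (by rw [not_le]; exact List.Lex.nil)
  | a :: x, b :: y, [], _, h => absurd h (by rw [not_le]; exact List.Lex.nil)
  | a :: x, b :: y, c :: z, h1, h2 => by
    rw [cons_le_cons_iff_lex] at h1 h2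
    rcases h1 with h1 | ⟨rfl, h1⟩
    · have hac : a ≠ c := by
        rcases h2 with h2 | ⟨rfl, h2⟩
        · exact (h1.trans h2).ne
        · exact h1.ne
      simp [lcp, hac, h1.ne]
    · rcases h2 with h2 | ⟨rfl, h2⟩
      · simp [lcp, h2.ne]
      · simp [lcp, length_lcp_eq_min x y z h1 h2]

end LCP

theorem exists_rank {α : Type*} [LinearOrder α] {X : Finset ℕ} (hX : X.Nonempty) (F : ℕ → α) :
    ∃ (U : ℕ → α) (rank : ℕ → ℕ), Monotone U ∧ (∀ i, ∃ p, U i = F p) ∧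
      ∀ p ∈ X, rank p < X.card ∧ U (rank p) = F p := by
  have hc : 0 < X.card := hX.card_pos
  set e := X.equivFin with he
  set f : Fin X.card → α := fun i => F (e.symm i) with hf
  -- The sorted sequence is continued by its last element, because the end of the last block may lie
  -- beyond the last rank.
  refine ⟨fun i => f (Tuple.sort f ⟨min i (X.card - 1), by omega⟩),
    fun p => if hp : p ∈ X then ((Tuple.sort f).symm (e ⟨p, hp⟩) : ℕ) else 0, ?_, ?_, ?_⟩
  · intro i j hij
    apply Tuple.monotone_sort f
    simp only [Fin.mk_le_mk]
    omega
  · intro i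
    exact ⟨_, rfl⟩
  · intro p hp
    simp only [hp, dif_pos]
    refine ⟨Fin.is_lt _, ?_⟩
    have h : ∀ k : Fin X.card, min (k : ℕ) (X.card - 1) = k := fun k => by omega
    simp [h, hf]

theorem length_suffixFrom_le {α : Type*} (T : List α) (f : ℕ) :
    (suffixFrom T f).length ≤ T.length := by
  rw [suffixFrom, List.length_drop]
  exact Nat.sub_le _ _

theorem suffixFrom_min {α : Type*} (T : List α) (f : ℕ) :
    suffixFrom T (min f T.length) = suffixFrom T f := by
  rcases le_total f T.length with h | h
  · rw [min_eq_left h]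
  · rw [min_eq_right h, suffixFrom, suffixFrom, List.drop_length, List.drop_eq_nil_of_le h]

/-! ### Difference cover -/

/-- Move `q` to a multiple of `m²` by `d < m²`, then `p + d` to a multiple of `m` by `e < m`. The
second move leaves `q` the residue `e`. -/
theorem exists_shift {m : ℕ} (hm : 0 < m) (p q : ℕ) :
    ∃ δ ≤ 2 * (m ^ 2 - 1), m ∣ p + δ ∧ (q + δ) % m ^ 2 < m := by
  have hM : 0 < m ^ 2 := by positivity
  have hmM : m ≤ m ^ 2 := by nlinarith
  generalize m ^ 2 = M at hM hmM ⊢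
  obtain ⟨d, hd, hqd⟩ : ∃ d < M, M ∣ q + d := by
    have := Nat.mod_lt q hM
    have h2 := Nat.div_add_mod q (M)
    by_cases h0 : q % M = 0
    · exact ⟨0, hM, Nat.dvd_of_mod_eq_zero (by simpa using h0)⟩
    · refine ⟨M - q % M, by omega, q / M + 1, ?_⟩
      rw [mul_add, mul_one]; omega
  obtain ⟨e, he, hpe⟩ : ∃ e < m, m ∣ p + d + e := by
    have := Nat.mod_lt (p + d) hm
    have h2 := Nat.div_add_mod (p + d) m
    by_cases h0 : (p + d) % m = 0
    · exact ⟨0, hm, Nat.dvd_of_mod_eq_zero (by simpa using h0)⟩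
    · refine ⟨m - (p + d) % m, by omega, (p + d) / m + 1, ?_⟩
      rw [mul_add, mul_one]; omega
  refine ⟨d + e, by omega, by rwa [← add_assoc], ?_⟩
  obtain ⟨k, hk⟩ := hqd
  rw [← add_assoc, hk, Nat.mul_add_mod, Nat.mod_eq_of_lt (he.trans_le hmM)]
  exact he

/-! ### Range minima -/

section RangeMin

variable {F : ℕ → ℕ → ℕ}

theorem eq_min_of_overlap (hF : ∀ i j k, i ≤ j → j ≤ k → F i k = min (F i j) (F j k))
    {i j k l : ℕ} (hij : i ≤ k) (hkj : k ≤ j) (hjl : j ≤ l) :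
    F i l = min (F i j) (F k l) := by
  have h1 := hF i j l (hij.trans hkj) hjl
  have h2 := hF k j l hkj hjl
  have h3 := hF i k j hij hkj
  omega

/-- A query between two blocks of length `b`: `u` and `v` are the numbers of the blocks. -/
theorem eq_min_of_blocks (hF : ∀ i j k, i ≤ j → j ≤ k → F i k = min (F i j) (F j k))
    {b lo hi u v l : ℕ} (hlo : lo ≤ (u + 1) * b) (hhi : v * b ≤ hi) (h1 : 2 ^ l ≤ v - u)
    (h2 : v - u < 2 ^ (l + 1)) :
    F lo hi = min (min (F lo ((u + 1) * b)) (F (v * b) hi))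
      (min (F ((u + 1) * b) ((u + 2 ^ l) * b))
        (F ((v - 2 ^ l + 1) * b) ((v - 2 ^ l + 2 ^ l) * b))) := by
  have hp : 0 < 2 ^ l := by positivity
  rw [pow_succ] at h2
  -- A sparse-table entry of level `l` spans `2 ^ l - 1` blocks, because the boundaries in question
  -- are `u + 1` and `v`. Adjacent blocks thus use level 0 with an empty span and are no special
  -- case.
  have e1 : (u + 1) * b ≤ v * b := Nat.mul_le_mul_right _ (by omega)
  have e2 : (u + 1) * b ≤ (v - 2 ^ l + 1) * b := Nat.mul_le_mul_right _ (by omega)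
  have e3 : (v - 2 ^ l + 1) * b ≤ (u + 2 ^ l) * b := Nat.mul_le_mul_right _ (by omega)
  have e4 : (u + 2 ^ l) * b ≤ v * b := Nat.mul_le_mul_right _ (by omega)
  rw [Nat.sub_add_cancel (by omega : 2 ^ l ≤ v), ← eq_min_of_overlap hF e2 e3 e4,
    hF lo ((u + 1) * b) hi hlo (e1.trans hhi), hF ((u + 1) * b) (v * b) hi e1 hhi]
  omega

/-- The positions of the block of `k` where the value of a query with right end `k` is attained. -/
def attained (F : ℕ → ℕ → ℕ) (b k : ℕ) : Finset ℕ :=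
  (Finset.range b).filter fun j => F (k / b * b + j) k = F (k / b * b + j) (k / b * b + j + 1)

/-- A query within a block of length `b`. -/
theorem query_within_block (hF : ∀ i j k, i ≤ j → j ≤ k → F i k = min (F i j) (F j k))
    {b lo hi : ℕ} (hb : 0 < b) (h : lo < hi) (hlh : lo / b = hi / b) :
    let j := sInf {j | lo % b ≤ j ∧ j ∈ attained F b hi}
    j < b ∧ lo / b * b + j < hi ∧
      F lo hi = F (lo / b * b + j) (lo / b * b + j + 1) := by
  intro j
  have hl := Nat.div_add_mod' lo b
  have hh := Nat.div_add_mod' hi b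
  have hhb := Nat.mod_lt hi hb
  -- The position just before `hi` always attains its own value, so the infimum is a true minimum
  -- and lies before `hi`.
  have hne : hi % b - 1 ∈ {j | lo % b ≤ j ∧ j ∈ attained F b hi} := by
    rw [hlh] at hl
    refine ⟨by omega, ?_⟩
    simp only [attained, Finset.mem_filter, Finset.mem_range]
    refine ⟨by omega, ?_⟩
    congr 1
    omega
  have hj : j ∈ {j | lo % b ≤ j ∧ j ∈ attained F b hi} := Nat.sInf_mem ⟨_, hne⟩
  have hle : j ≤ hi % b - 1 := Nat.sInf_le hne
  obtain ⟨hj1, hj2⟩ := hj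
  simp only [attained, Finset.mem_filter, Finset.mem_range, ← hlh] at hj2
  rw [← hlh] at hh
  have hlt : lo / b * b + j < hi := by omega
  refine ⟨hj2.1, hlt, ?_⟩
  -- A left end where the value is not attained can be dropped without changing the minimum.
  have key : ∀ t, lo % b + t ≤ j → F lo hi = F (lo / b * b + (lo % b + t)) hi := by
    intro t
    induction t with
    | zero => intro _; rw [add_zero, hl]
    | succ t ih =>
      intro ht
      rw [ih (by omega)]
      have h1 := hF (lo / b * b + (lo % b + t)) (lo / b * b + (lo % b + t) + 1) hi (by omega)
        (by omega)
      have h2 : F (lo / b * b + (lo % b + t)) hi ≠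
          F (lo / b * b + (lo % b + t)) (lo / b * b + (lo % b + t) + 1) := by
        intro h2
        have : lo % b + t ∈ {j | lo % b ≤ j ∧ j ∈ attained F b hi} := by
          refine ⟨by omega, ?_⟩
          simp only [attained, Finset.mem_filter, Finset.mem_range, ← hlh]
          exact ⟨by omega, h2⟩
        have : j ≤ lo % b + t := Nat.sInf_le this
        omega
      have h3 : lo / b * b + (lo % b + (t + 1)) = lo / b * b + (lo % b + t) + 1 := by omega
      rw [h3]
      omega
  have h4 := key (j - lo % b) (by omega)
  rw [Nat.add_sub_cancel' hj1] at h4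
  rw [h4, hj2.2]

end RangeMin

/-! ### Numbering of finite sets -/

theorem exists_numbering {α β : Type*} [Nonempty α] [Fintype β] (X : Set α) (f : α → β)
    (hf : X.InjOn f) : ∃ (code : α → ℕ) (dec : ℕ → α), (∀ x, code x < Fintype.card β) ∧
      ∀ x ∈ X, dec (code x) = x := by
  refine ⟨fun x => Fintype.equivFin β (f x),
    fun c => Function.invFunOn (fun x => (Fintype.equivFin β (f x) : ℕ)) X c,
    fun x => Fin.is_lt _, fun x hx => ?_⟩
  refine Set.InjOn.leftInvOn_invFunOn (f := fun x => (Fintype.equivFin β (f x) : ℕ)) ?_ hx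
  intro a ha c hc h
  exact hf ha hc ((Fintype.equivFin β).injective (Fin.ext h))

/-- The base is `σ + 1` because strings shorter than `h` are padded with one extra symbol, `none`.
-/
theorem exists_numbering_strings (σ h : ℕ) : ∃ (code : List (Fin σ) → ℕ) (dec : ℕ → List (Fin σ)),
    (∀ x, code x < (σ + 1) ^ h) ∧ ∀ x, x.length ≤ h → dec (code x) = x := by
  obtain ⟨code, dec, h1, h2⟩ := exists_numbering {x : List (Fin σ) | x.length ≤ h}
    (fun x (j : Fin h) => x[(j : ℕ)]?) (by
      intro x hx y hy hxy
      simp only [Set.mem_ofPred_eq] at hx hy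
      refine List.ext_getElem? fun i => ?_
      by_cases hi : i < h
      · exact congrFun hxy ⟨i, hi⟩
      · rw [List.getElem?_eq_none (by omega), List.getElem?_eq_none (by omega)])
  refine ⟨code, dec, fun x => ?_, fun x hx => h2 x hx⟩
  simpa using h1 x

theorem exists_numbering_subsets (b : ℕ) : ∃ (code : Finset ℕ → ℕ) (dec : ℕ → Finset ℕ),
    (∀ x, code x < 2 ^ b) ∧ ∀ x ⊆ Finset.range b, dec (code x) = x := by
  obtain ⟨code, dec, h1, h2⟩ := exists_numbering {x : Finset ℕ | x ⊆ Finset.range b}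
    (fun x (j : Fin b) => decide ((j : ℕ) ∈ x)) (by
      intro x hx y hy hxy
      ext i
      by_cases hi : i < b
      · simpa using congrFun hxy ⟨i, hi⟩
      · have h1 : i ∉ x := fun h => hi (by simpa using hx h)
        have h2 : i ∉ y := fun h => hi (by simpa using hy h)
        simp [h1, h2])
  refine ⟨code, dec, fun x => ?_, fun x hx => h2 x hx⟩
  simpa using h1 x

/-! ### Selected positions -/

theorem coverMark_mono (r : ℕ) : Monotone (coverMark r) :=
  monotone_nat_of_le_succ fun i => by simp [coverMark]

theorem coverMark_add {r a g : ℕ} : ∀ t, (∀ i, a < i → i ≤ a + t → coverGap r i = g) →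
    coverMark r (a + t) = coverMark r a + t * g
  | 0, _ => by simp
  | t + 1, h => by
    rw [← add_assoc, coverMark, coverMark_add t fun i h1 h2 => h i h1 (by omega),
      h _ (by omega) (by omega)]
    ring

/-- The gaps form six constant runs. The last mark is already the start of the next block, so a
selected position can equal `n`. -/
theorem coverMark_last (r : ℕ) : coverMark r (6 * r + 3) = blockLength r := by
  have h1 := coverMark_add (r := r) (a := 0) (g := 1) r fun i h1 h2 => by
    simp only [coverGap]; split_ifs <;> omega
  have h2 := coverMark_add (r := r) (a := 0 + r) (g := r + 1) 1 fun i h1 h2 => by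
    simp only [coverGap]; split_ifs <;> omega
  have h3 := coverMark_add (r := r) (a := 0 + r + 1) (g := 2 * r + 1) r fun i h1 h2 => by
    simp only [coverGap]; split_ifs <;> omega
  have h4 := coverMark_add (r := r) (a := 0 + r + 1 + r) (g := 4 * r + 3) (2 * r + 1)
    fun i h1 h2 => by simp only [coverGap]; split_ifs <;> omega
  have h5 := coverMark_add (r := r) (a := 0 + r + 1 + r + (2 * r + 1)) (g := 2 * r + 2) (r + 1)
    fun i h1 h2 => by simp only [coverGap]; split_ifs <;> omega
  have h6 := coverMark_add (r := r) (a := 0 + r + 1 + r + (2 * r + 1) + (r + 1)) (g := 1) r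
    fun i h1 h2 => by simp only [coverGap]; split_ifs <;> omega
  rw [show 6 * r + 3 = 0 + r + 1 + r + (2 * r + 1) + (r + 1) + r by ring, h6, h5, h4, h3, h2, h1]
  simp only [coverMark, blockLength]
  ring

theorem IsSelected.le {n r f : ℕ} (h : IsSelected n r f) : f ≤ n := by
  obtain ⟨q, j, hq, hj, rfl⟩ := h
  have h1 := (coverMark_mono r hj).trans_eq (coverMark_last r)
  have h2 : blockLength r * (q + 1) ≤ blockLength r * (n / blockLength r) :=
    Nat.mul_le_mul_left _ hq
  have h3 := Nat.mul_div_le n (blockLength r)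
  rw [mul_add, mul_one] at h2
  omega

/-! ### Parameters of the data structure -/

/-- Sampling distance `m`, length `b` of the blocks of sorted suffixes, and a bound `s` for the
sizes of the lookup tables. -/
structure GoodParams (n σ m b s : ℕ) : Prop where
  m_pos : 0 < m
  s_sq : s * s ≤ n
  s_ge : 64 ≤ s
  m_sq : (m ^ 2) ^ 2 ≤ s
  windows : ((σ + 1) ^ (2 * (2 * (m ^ 2 - 1))) * (2 * (m ^ 2 - 1) + 1)) ^ 2 ≤ s
  masks : 2 ^ b * b ≤ s
  levels : 2 * (Nat.log 2 n / 64 + 1) ≤ b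
  sqrt_log : √(Real.logb 2 n) ≤ 20 * m * √(Real.logb 2 σ)

theorem exists_goodParams {n σ : ℕ} (hn : 128 ≤ Nat.log 2 n) (hσ : 2 ≤ σ) :
    ∃ m b s, GoodParams n σ m b s := by
  have hn0 : n ≠ 0 := by rintro rfl; simp at hn
  have hpow : 2 ^ Nat.log 2 n ≤ n := Nat.pow_log_le_self 2 hn0
  have hpow' : n < 2 ^ (Nat.log 2 n + 1) := Nat.lt_pow_succ_log_self one_lt_two n
  have hβ : σ + 1 ≤ 2 ^ (Nat.log 2 σ + 1) := Nat.lt_pow_succ_log_self one_lt_two σ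
  set lg := Nat.log 2 n
  have hβσ : 2 ^ Nat.log 2 σ ≤ σ := Nat.pow_log_le_self 2 (by omega)
  set β := Nat.log 2 σ + 1 with hβd
  have hβ0 : 0 < β := by omega
  -- The factor 24 makes the window table fit into `2 ^ (lg / 2)` entries. If `σ` is so large that
  -- `m = 1`, then `m ^ 2 - 1 = 0` and the windows are empty.
  set m := max 1 (Nat.sqrt (lg / (24 * β))) with hm
  have hm1 : 1 ≤ m := le_max_left _ _
  have hmM : (m ^ 2 - 1) * β * 24 ≤ lg := by
    rcases le_total (Nat.sqrt (lg / (24 * β))) 1 with h | h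
    · simp [hm, max_eq_left h]
    · rw [hm, max_eq_right h]
      have h1 := Nat.sqrt_le' (lg / (24 * β))
      have h2 := Nat.div_mul_le_self lg (24 * β)
      calc _ ≤ (lg / (24 * β)) * β * 24 := by gcongr; omega
        _ = lg / (24 * β) * (24 * β) := by ring
        _ ≤ lg := h2
  have hml : lg < 96 * β * m ^ 2 := by
    have h1 := Nat.lt_succ_sqrt' (lg / (24 * β))
    have h2 : Nat.succ (Nat.sqrt (lg / (24 * β))) ≤ 2 * m := by
      have : Nat.sqrt (lg / (24 * β)) ≤ m := le_max_right _ _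
      omega
    have h3 : lg / (24 * β) < (2 * m) ^ 2 := h1.trans_le (Nat.pow_le_pow_left h2 2)
    rw [Nat.div_lt_iff_lt_mul (by omega)] at h3
    calc lg < (2 * m) ^ 2 * (24 * β) := h3
      _ = _ := by ring
  have hM : 1 ≤ m ^ 2 := Nat.one_le_pow _ _ hm1
  have hM24 : (m ^ 2 - 1) * 24 ≤ lg := by
    refine le_trans ?_ hmM
    gcongr
    exact Nat.le_mul_of_pos_right _ hβ0
  refine ⟨m, lg / 8 + 1, 2 ^ (lg / 2), hm1, ?_, ?_, ?_, ?_, ?_, by omega, ?_⟩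
  · rw [← pow_add]
    exact (Nat.pow_le_pow_right two_pos (by omega)).trans hpow
  · calc 64 = 2 ^ 6 := by norm_num
      _ ≤ _ := Nat.pow_le_pow_right two_pos (by omega)
  · calc (m ^ 2) ^ 2 ≤ (2 ^ (m ^ 2)) ^ 2 := Nat.pow_le_pow_left Nat.lt_two_pow_self.le 2
      _ = 2 ^ (m ^ 2 * 2) := by rw [← pow_mul]
      _ ≤ _ := Nat.pow_le_pow_right two_pos (by omega)
  · set h := 2 * (m ^ 2 - 1) with hh
    calc ((σ + 1) ^ (2 * h) * (h + 1)) ^ 2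
        ≤ ((2 ^ β) ^ (2 * h) * 2 ^ (β * h)) ^ 2 := by
          gcongr
          have : h + 1 ≤ 2 ^ h := Nat.lt_two_pow_self
          refine this.trans (Nat.pow_le_pow_right two_pos ?_)
          exact Nat.le_mul_of_pos_left _ hβ0
      _ = 2 ^ (6 * (h * β)) := by
          rw [← pow_mul, ← pow_add, ← pow_mul]; congr 1; ring
      _ ≤ 2 ^ (lg / 2) := by
          refine Nat.pow_le_pow_right two_pos ?_
          have : h * β = 2 * ((m ^ 2 - 1) * β) := by rw [hh]; ring
          omega
  · calc 2 ^ (lg / 8 + 1) * (lg / 8 + 1) ≤ 2 ^ (lg / 8 + 1) * 2 ^ (lg / 8 + 1) := by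
          gcongr; exact Nat.lt_two_pow_self.le
      _ = 2 ^ (lg / 8 + 1 + (lg / 8 + 1)) := by rw [← pow_add]
      _ ≤ _ := Nat.pow_le_pow_right two_pos (by omega)
  · have h1 : Real.logb 2 n ≤ lg + 1 := by
      rw [Real.logb_le_iff_le_rpow one_lt_two (by positivity)]
      exact_mod_cast hpow'.le
    have h2 : ((β : ℝ) - 1) ≤ Real.logb 2 σ := by
      rw [Real.le_logb_iff_rpow_le one_lt_two (by positivity), hβd]
      push_cast
      rw [add_sub_cancel_right]
      exact_mod_cast hβσ
    have h3 : 1 ≤ Real.logb 2 σ := by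
      rw [Real.le_logb_iff_rpow_le one_lt_two (by positivity)]
      simpa using hσ
    have h4 : (lg : ℝ) + 1 ≤ 96 * β * m ^ 2 := by exact_mod_cast hml
    rw [show (20 : ℝ) * m = √((20 * m) ^ 2) by rw [Real.sqrt_sq]; positivity,
      ← Real.sqrt_mul (by positivity)]
    apply Real.sqrt_le_sqrt
    have h5 : (β : ℝ) * m ^ 2 ≤ 2 * Real.logb 2 σ * m ^ 2 := by gcongr; linarith
    have h6 : 0 ≤ Real.logb 2 σ * m ^ 2 := by positivity
    nlinarith

namespace GoodParams

variable {n σ m b s : ℕ} (h : GoodParams n σ m b s)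
include h

theorem m_le : m ≤ s := by
  have h1 := h.m_sq
  have h2 := h.m_pos
  have h3 : m ≤ m ^ 2 := by nlinarith
  have h4 : m ^ 2 ≤ (m ^ 2) ^ 2 := by nlinarith
  omega

theorem m_sq_le : m ^ 2 ≤ s := by
  have h1 := h.m_sq
  have h2 := h.m_pos
  have h3 : m ≤ m ^ 2 := by nlinarith
  have h4 : m ^ 2 ≤ (m ^ 2) ^ 2 := by nlinarith
  omega

theorem s_le : 64 * s ≤ n := (Nat.mul_le_mul_right s h.s_ge).trans h.s_sq

theorem two_le_b : 2 ≤ b := by have := h.levels; omega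

theorem b_le : b ≤ s := (Nat.le_mul_of_pos_left b (by positivity)).trans h.masks

theorem mul_m_le {a : ℕ} (ha : a ≤ s) : a * m ≤ n :=
  (Nat.mul_le_mul ha h.m_le).trans h.s_sq

end GoodParams

/-- The sampled positions of a text of length `n`. -/
def samples (n m : ℕ) : Finset ℕ :=
  (Finset.range (n + 1)).filter fun p => m ∣ p ∨ p % m ^ 2 < m

theorem samples_card_le {n m : ℕ} (hm : 0 < m) :
    (samples n m).card ≤ n / m + 1 + (n / m ^ 2 + 1) * m := by
  have h : samples n m ⊆ (Finset.range (n / m + 1)).image (fun k => k * m) ∪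
      (Finset.range ((n / m ^ 2 + 1) * m)).image (fun k => k / m * m ^ 2 + k % m) := by
    intro p hp
    simp only [samples, Finset.mem_filter, Finset.mem_range] at hp
    simp only [Finset.mem_union, Finset.mem_image, Finset.mem_range]
    rcases hp with ⟨hpn, hp | hp⟩
    · refine .inl ⟨p / m, ?_, Nat.div_mul_cancel hp⟩
      have := Nat.div_le_div_right (c := m) (Nat.le_of_lt_succ hpn)
      omega
    · refine .inr ⟨p / m ^ 2 * m + p % m ^ 2, ?_, ?_⟩
      · have h1 := Nat.div_le_div_right (c := m ^ 2) (Nat.le_of_lt_succ hpn)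
        have h2 : (p / m ^ 2 + 1) * m ≤ (n / m ^ 2 + 1) * m := by gcongr
        rw [add_mul, one_mul] at h2
        omega
      · rw [add_comm (p / m ^ 2 * m), Nat.add_mul_div_right _ _ hm, Nat.div_eq_of_lt hp, zero_add,
          Nat.add_mul_mod_self_right, Nat.mod_eq_of_lt hp, Nat.div_add_mod']
  refine (Finset.card_le_card h).trans ((Finset.card_union_le _ _).trans ?_)
  have h1 := Finset.card_image_le (s := Finset.range (n / m + 1)) (f := fun k => k * m)
  have h2 := Finset.card_image_le (s := Finset.range ((n / m ^ 2 + 1) * m))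
    (f := fun k => k / m * m ^ 2 + k % m)
  rw [Finset.card_range] at h1 h2
  exact add_le_add h1 h2

theorem samples_card_le_succ (n m : ℕ) : (samples n m).card ≤ n + 1 :=
  (Finset.card_filter_le _ _).trans_eq (Finset.card_range _)

theorem zero_mem_samples (n m : ℕ) : 0 ∈ samples n m := by simp [samples]

/-- Lengths of the memory arrays. -/
def arrayLength (n σ m b N : ℕ) : ℕ → ℕ
  | 0 => 8
  | 1 => n / (2 * (m ^ 2 - 1) + 1) + 1
  | 2 => ((σ + 1) ^ (2 * (2 * (m ^ 2 - 1))) * (2 * (m ^ 2 - 1) + 1)) ^ 2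
  | 3 => (m ^ 2) ^ 2
  | 4 => n / m + 1
  | 5 => (n / m ^ 2 + 1) * m
  | 6 => N
  | 7 => N
  | 8 => N
  | 9 => N
  | 10 => 2 ^ b * b
  | 11 => N / b + 2
  | 12 => N / b + 2
  | 13 => N / b + 2
  | _ => (Nat.log 2 n / 64 + 1) * (N / b + 1)

/-- The first bound makes every index fit into a word, the second one gives the space. Lookup tables
have at most `s ≤ √n` entries; the other arrays are governed by the number of samples or by `n / m`.
-/
theorem GoodParams.arrayLength_le {n σ m b s : ℕ} (h : GoodParams n σ m b s) (a : ℕ) :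
    arrayLength n σ m b (samples n m).card a ≤ n + 1 ∧
      arrayLength n σ m b (samples n m).card a * m ≤ 8 * n := by
  have hm := h.m_pos
  have hmn : m ≤ n := by have := h.m_le; have := h.s_le; omega
  have hmm : m * m ≤ n := h.mul_m_le h.m_le
  have hs := h.s_le
  have h64 := h.s_ge
  have hN := samples_card_le_succ n m
  have hN' := samples_card_le (n := n) hm
  set N := (samples n m).card
  have hA : n / m * m ≤ n := Nat.div_mul_le_self n m
  have hA' : n / m ≤ n := Nat.div_le_self n m
  have hB : (n / m ^ 2) * m * m ≤ n := by
    have := Nat.div_mul_le_self n (m ^ 2)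
    rw [sq, ← mul_assoc] at this
    rwa [sq]
  have hNm : N * m ≤ 4 * n := by
    calc N * m ≤ (n / m + 1 + (n / m ^ 2 + 1) * m) * m := by gcongr
      _ = n / m * m + m + ((n / m ^ 2) * m * m + m * m) := by ring
      _ ≤ _ := by omega
  have hsm := h.mul_m_le le_rfl
  have table : ∀ x ≤ s, x ≤ n + 1 ∧ x * m ≤ 8 * n := fun x hx =>
    ⟨by omega, (h.mul_m_le hx).trans (by omega)⟩
  have hb := h.two_le_b
  have hbs := h.b_le
  have hNb : N / b ≤ N / 2 := Nat.div_le_div_left hb two_pos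
  have logs : N / b + 2 ≤ n + 1 ∧ (N / b + 2) * m ≤ 8 * n := by
    refine ⟨by omega, ?_⟩
    have : N / b * m ≤ N * m := by gcongr; exact Nat.div_le_self _ _
    rw [add_mul]; omega
  unfold arrayLength
  split
  · exact table _ (by omega)
  · refine ⟨by gcongr; exact Nat.div_le_self _ _, ?_⟩
    have h1 : m ≤ 2 * (m ^ 2 - 1) + 1 := by
      have : m ≤ m ^ 2 := by nlinarith
      omega
    have h2 : n / (2 * (m ^ 2 - 1) + 1) ≤ n / m := Nat.div_le_div_left h1 hm
    have h3 : n / (2 * (m ^ 2 - 1) + 1) * m ≤ n / m * m := by gcongr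
    rw [add_mul]; omega
  · exact table _ h.windows
  · exact table _ h.m_sq
  · refine ⟨by omega, ?_⟩
    rw [add_mul]; omega
  · constructor
    · rcases Nat.lt_or_ge 1 m with h1 | h1
      · have h2 : n / m ^ 2 * m * 2 ≤ n / m ^ 2 * m * m := by gcongr; exact h1
        have := h.m_le
        rw [add_mul]; omega
      · obtain rfl : m = 1 := by omega
        simp
    · rw [add_mul, add_mul, one_mul]; omega
  all_goals try exact ⟨hN, by omega⟩
  · exact table _ h.masks
  all_goals try exact logs
  -- One array for all levels could be longer than `2 ^ w`; the levels are spread over 64 arrays by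
  -- their residue.
  · have h1 : 2 * ((Nat.log 2 n / 64 + 1) * (N / b + 1)) ≤ N + b := by
      calc _ = 2 * (Nat.log 2 n / 64 + 1) * (N / b + 1) := by ring
        _ ≤ b * (N / b + 1) := by gcongr; exact h.levels
        _ = b * (N / b) + b := by ring
        _ ≤ N + b := by gcongr; exact Nat.mul_div_le N b
    refine ⟨by omega, ?_⟩
    have h2 : (Nat.log 2 n / 64 + 1) * (N / b + 1) * m ≤ (N + b) * m := by gcongr; omega
    have h3 := h.mul_m_le hbs
    rw [add_mul N] at h2
    omega

/-! ### The contents of the memory -/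

/-- Numberings and ranks from which the memory arrays of a text are computed. -/
structure TextIndex {σ : ℕ} (T : List (Fin σ)) (m b : ℕ) where
  code : List (Fin σ) → ℕ
  dec : ℕ → List (Fin σ)
  code_lt : ∀ x, code x < (σ + 1) ^ (2 * (2 * (m ^ 2 - 1)))
  dec_code : ∀ x, x.length ≤ 2 * (2 * (m ^ 2 - 1)) → dec (code x) = x
  maskCode : Finset ℕ → ℕ
  maskDec : ℕ → Finset ℕ
  maskCode_lt : ∀ x, maskCode x < 2 ^ b
  maskDec_maskCode : ∀ x ⊆ Finset.range b, maskDec (maskCode x) = x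
  shift : ℕ → ℕ → ℕ
  shift_le : ∀ p q, shift p q ≤ 2 * (m ^ 2 - 1)
  dvd_add_shift : ∀ p q, m ∣ p + shift (p % m ^ 2) (q % m ^ 2)
  add_shift_mod : ∀ p q, (q + shift (p % m ^ 2) (q % m ^ 2)) % m ^ 2 < m
  sorted : ℕ → List (Fin σ)
  rank : ℕ → ℕ
  sorted_mono : Monotone sorted
  length_sorted : ∀ i, (sorted i).length ≤ T.length
  rank_lt : ∀ p ∈ samples T.length m, rank p < (samples T.length m).card
  sorted_rank : ∀ p ∈ samples T.length m, sorted (rank p) = suffixFrom T p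

theorem nonempty_textIndex {σ m : ℕ} (T : List (Fin σ)) (hm : 0 < m) (b : ℕ) :
    Nonempty (TextIndex T m b) := by
  obtain ⟨code, dec, h1, h2⟩ := exists_numbering_strings σ (2 * (2 * (m ^ 2 - 1)))
  obtain ⟨mcode, mdec, h3, h4⟩ := exists_numbering_subsets b
  choose shift h5 h6 h7 using exists_shift hm
  obtain ⟨U, rank, h8, h9, h10⟩ := exists_rank ⟨0, zero_mem_samples T.length m⟩ (suffixFrom T)
  refine ⟨⟨code, dec, h1, h2, mcode, mdec, h3, h4, shift, h5, fun p q => ?_, fun p q => ?_, U, rank,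
    h8, fun i => ?_, fun p hp => (h10 p hp).1, fun p hp => (h10 p hp).2⟩⟩
  -- Since `m ∣ m ^ 2`, the shift depends on residues only, and a table of `(m ^ 2) ^ 2` entries
  -- suffices.
  · have h := h6 (p % m ^ 2) (q % m ^ 2)
    generalize shift (p % m ^ 2) (q % m ^ 2) = δ at h ⊢
    rw [← Nat.div_add_mod p (m ^ 2), add_assoc]
    exact dvd_add (Dvd.dvd.mul_right (dvd_pow_self m two_ne_zero) _) h
  · have h := h7 (p % m ^ 2) (q % m ^ 2)
    generalize shift (p % m ^ 2) (q % m ^ 2) = δ at h ⊢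
    rwa [← Nat.div_add_mod q (m ^ 2), add_assoc, Nat.mul_add_mod]
  · obtain ⟨p, hp⟩ := h9 i
    rw [hp]
    exact length_suffixFrom_le T p

namespace TextIndex

variable {σ m b : ℕ} {T : List (Fin σ)} (I : TextIndex T m b)

/-- Length of the longest common prefix of two sampled suffixes, given by their ranks. -/
def rankLcp (i k : ℕ) : ℕ := (lcp (I.sorted i) (I.sorted k)).length

theorem rankLcp_le (i k : ℕ) : I.rankLcp i k ≤ T.length :=
  (length_lcp_le_left _ _).trans (I.length_sorted i)

theorem rankLcp_eq_min (i j k : ℕ) (hij : i ≤ j) (hjk : j ≤ k) :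
    I.rankLcp i k = min (I.rankLcp i j) (I.rankLcp j k) :=
  length_lcp_eq_min _ _ _ (I.sorted_mono hij) (I.sorted_mono hjk)

/-- Entries of the memory arrays. -/
noncomputable def entry : ℕ → ℕ → ℕ
  | 0, x => [1, T.length, 2 * (m ^ 2 - 1) + 1, (σ + 1) ^ (2 * (2 * (m ^ 2 - 1))), m ^ 2, m, b,
      2 * (m ^ 2 - 1)].getD x 0
  | 1, x => I.code ((T.drop (x * (2 * (m ^ 2 - 1) + 1))).take (2 * (2 * (m ^ 2 - 1))))
  | 2, x =>
    let B := 2 * (m ^ 2 - 1) + 1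
    let E := (σ + 1) ^ (2 * (2 * (m ^ 2 - 1)))
    (lcp (((I.dec (x / B / E / B)).drop (x / B / E % B)).take (2 * (m ^ 2 - 1)))
      (((I.dec (x / B % E)).drop (x % B)).take (2 * (m ^ 2 - 1)))).length
  | 3, x => I.shift (x / m ^ 2) (x % m ^ 2)
  | 4, x => I.rank (x * m)
  | 5, x => I.rank (x / m * m ^ 2 + x % m)
  | 6, x => I.rankLcp x ((x / b + 1) * b)
  | 7, x => I.rankLcp (x / b * b) x
  | 8, x => I.rankLcp x (x + 1)
  | 9, x => I.maskCode (attained I.rankLcp b x)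
  | 10, x => sInf {j | x % b ≤ j ∧ j ∈ I.maskDec (x / b)}
  | 11, x => Nat.log 2 x % 64
  | 12, x => Nat.log 2 x / 64 * ((samples T.length m).card / b + 1)
  | 13, x => 2 ^ Nat.log 2 x
  | t, x =>
    let K := (samples T.length m).card / b + 1
    I.rankLcp ((x % K + 1) * b) ((x % K + 2 ^ (x / K * 64 + (t - 32))) * b)

theorem entry_levels (t x : ℕ) : I.entry (32 + t) x =
    let K := (samples T.length m).card / b + 1
    I.rankLcp ((x % K + 1) * b) ((x % K + 2 ^ (x / K * 64 + t)) * b) := by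
  unfold entry
  split <;> first | omega | simp

theorem arrayLength_levels (n N t : ℕ) :
    arrayLength n σ m b N (32 + t) = (Nat.log 2 n / 64 + 1) * (N / b + 1) := by
  unfold arrayLength
  split <;> omega

end TextIndex

/-! ### The query program -/

namespace WordRAM.Expr

/-- The parameter with the number `j`. -/
def param (j : ℕ) : Expr := load 0 (const j)

/-- The position `f₁ + i`, or the text length if it is smaller. -/
def firstPos : Expr :=
  sel (op .lt (arg 2) (op .sub (param 1) (arg 0))) (op .add (arg 0) (arg 2)) (param 1)

/-- Longest common prefix of the windows at two positions. -/
def windowLcp (p q : Expr) : Expr :=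
  load 2 (op .add (op .mul (op .add (op .mul (op .add
    (op .mul (load 1 (op .div p (param 2))) (param 2)) (op .mod p (param 2))) (param 3))
    (load 1 (op .div q (param 2)))) (param 2)) (op .mod q (param 2)))

/-- Shift that moves two positions to sampled positions. -/
def shift (p q : Expr) : Expr :=
  load 3 (op .add (op .mul (op .mod p (param 4)) (param 4)) (op .mod q (param 4)))

/-- Rank of the suffix at a multiple of the sampling distance. -/
def rankMultiple (p : Expr) : Expr := load 4 (op .div p (param 5))

/-- Rank of the suffix at a position with a small residue. -/
def rankResidue (q : Expr) : Expr :=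
  load 5 (op .add (op .mul (op .div q (param 4)) (param 5)) (op .mod q (param 4)))

/-- Longest common prefix of two sorted suffixes in the same block. -/
def sameBlock (lo hi : Expr) : Expr :=
  load 8 (op .add (op .mul (op .div lo (param 6)) (param 6))
    (load 10 (op .add (op .mul (load 9 hi) (param 6)) (op .mod lo (param 6)))))

/-- Longest common prefix of two suffixes at the starts of blocks; `d` is the block distance and
`u` the number of a block. -/
def blockLevel (d u : Expr) : Expr :=
  loadFrom 32 (load 11 d) (op .add (load 12 d) u) 0 64

/-- Longest common prefix of two sorted suffixes in different blocks. -/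
def otherBlock (lo hi : Expr) : Expr :=
  let u := op .div lo (param 6)
  let v := op .div hi (param 6)
  let d := op .sub v u
  Expr.min (Expr.min (load 6 lo) (load 7 hi)) (Expr.min (blockLevel d u) (blockLevel d (op .sub v (load 13 d))))

/-- Longest common prefix of two sorted suffixes. -/
def sortedLcp (lo hi : Expr) : Expr :=
  sel (op .eq (op .div lo (param 6)) (op .div hi (param 6))) (sameBlock lo hi) (otherBlock lo hi)

/-- Longest common prefix of two sampled suffixes given by their ranks. -/
def rankLcp (x y : Expr) : Expr := sel (op .lt x y) (sortedLcp x y) (sortedLcp y x)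

/-- Longest common prefix of the suffixes at two positions. -/
def posLcp (p q : Expr) : Expr :=
  sel (op .eq p q) (op .sub (param 1) p)
    (sel (op .eq (windowLcp p q) (param 7))
      (op .add (shift p q) (rankLcp (rankMultiple (op .add p (shift p q)))
        (rankResidue (op .add q (shift p q))))) (windowLcp p q))

/-- The query; texts shorter than `n₀` are answered from a table of all answers. -/
def query (n₀ : ℕ) : Expr :=
  sel (param 0) (posLcp firstPos (arg 1)) (loadFrom 32 firstPos (arg 1) 0 n₀)

end WordRAM.Expr

/-! ### Correctness of the query expression -/

section Correctness

open WordRAM WordRAM.Expr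

theorem mul_add_div_of_lt {x K u : ℕ} (h : u < K) : (x * K + u) / K = x := by
  rw [add_comm, Nat.add_mul_div_right _ _ (by omega), Nat.div_eq_of_lt h, zero_add]

theorem mul_add_mod_of_lt {x K u : ℕ} (h : u < K) : (x * K + u) % K = u := by
  rw [add_comm, Nat.add_mul_mod_self_right, Nat.mod_eq_of_lt h]

theorem mul_add_lt_mul {x X K u : ℕ} (hx : x < X) (h : u < K) : x * K + u < X * K := by
  calc x * K + u < x * K + K := by omega
    _ = (x + 1) * K := by ring
    _ ≤ X * K := Nat.mul_le_mul_right _ hx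

theorem den_param {w : ℕ} {M : ℕ → BitVec w → BitVec w} {args : List (BitVec w)} {F : ℕ → ℕ}
    {j x len : ℕ} (hM : Holds M 0 len F) (hF : F j = x) (hj : j < len) : Den M args (param j) x :=
  hF ▸ Den.load hM (Den.const j) hj

theorem den_firstPos {w : ℕ} {M : ℕ → BitVec w → BitVec w} {f₁ f₂ i n len : ℕ}
    {F : ℕ → ℕ} (hM : Holds M 0 len F) (hlen : 1 < len) (hF : F 1 = n) (hn : n < 2 ^ w) (hf : f₁ ≤ n) (hi : i < 2 ^ w) :
    Den M [BitVec.ofNat w f₁, BitVec.ofNat w f₂, BitVec.ofNat w i] firstPos (min (f₁ + i) n) := by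
  have h1 : Den M [BitVec.ofNat w f₁, BitVec.ofNat w f₂, BitVec.ofNat w i] (arg 0) f₁ := rfl
  have h2 : Den M [BitVec.ofNat w f₁, BitVec.ofNat w f₂, BitVec.ofNat w i] (arg 2) i := rfl
  have h3 : Den M [BitVec.ofNat w f₁, BitVec.ofNat w f₂, BitVec.ofNat w i] (param 1) n :=
    den_param hM hF hlen
  -- The test is `i < n - f₁`, since `f₁ + i` might overflow.
  refine Den.sel_lt h2 (h3.sub h1 hf) hi (by omega) (fun h => ?_) (fun h => ?_)
  · rw [min_eq_left (by omega)]; exact h1.add h2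
  · rwa [min_eq_right (by omega)]

variable {σ m b s w : ℕ} {T : List (Fin σ)} {M : ℕ → BitVec w → BitVec w}
  {args : List (BitVec w)} (G : GoodParams T.length σ m b s) (I : TextIndex T m b)
  (hM : ∀ a < 96, Holds M a (arrayLength T.length σ m b (samples T.length m).card a) (I.entry a))
  (hw : T.length < 2 ^ w)
include G hM hw

/-- Codes are stored only for windows of length `2 * h` at multiples of `h + 1`. An offset is at
most `h`, so the next `h` characters lie inside the window. The table index packs both codes and
offsets in mixed radix. -/
theorem den_window {p q : ℕ} {ep eq : Expr} (hp : Den M args ep p) (hq : Den M args eq q)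
    (hpn : p ≤ T.length) (hqn : q ≤ T.length) :
    Den M args (windowLcp ep eq)
      (min (2 * (m ^ 2 - 1)) (lcp (suffixFrom T p) (suffixFrom T q)).length) := by
  have hs := G.s_le
  have hwin := G.windows
  set h := 2 * (m ^ 2 - 1) with hh
  have hB : Den M args (param 2) (h + 1) := den_param (j := 2) (hM 0 (by omega)) rfl (by simp [arrayLength])
  have hE : Den M args (param 3) ((σ + 1) ^ (2 * h)) :=
    den_param (j := 3) (hM 0 (by omega)) rfl (by simp [arrayLength])
  set E := (σ + 1) ^ (2 * h) with hEd
  have hE0 : 0 < E := by positivity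
  have hBs : h + 1 ≤ s := by
    have h1 : h + 1 ≤ E * (h + 1) := Nat.le_mul_of_pos_left _ hE0
    have h2 : E * (h + 1) ≤ (E * (h + 1)) ^ 2 := Nat.le_self_pow two_ne_zero _
    omega
  have blk : ∀ {x : ℕ} {ex : Expr}, Den M args ex x → x ≤ T.length →
      Den M args (load 1 (op .div ex (param 2)))
        (I.code ((T.drop (x / (h + 1) * (h + 1))).take (2 * h))) := by
    intro x ex hx hxn
    refine Den.load (hM 1 (by omega)) (hx.div hB (by omega) (by omega)) ?_
    exact Nat.lt_succ_of_le (Nat.div_le_div_right hxn)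
  have off : ∀ {x : ℕ} {ex : Expr}, Den M args ex x → x ≤ T.length →
      Den M args (op .mod ex (param 2)) (x % (h + 1)) :=
    fun hx hxn => hx.mod hB (by omega) (by omega)
  have hpo : p % (h + 1) < h + 1 := Nat.mod_lt _ (by omega)
  have hqo : q % (h + 1) < h + 1 := Nat.mod_lt _ (by omega)
  have hpc := I.code_lt ((T.drop (p / (h + 1) * (h + 1))).take (2 * h))
  have hqc := I.code_lt ((T.drop (q / (h + 1) * (h + 1))).take (2 * h))
  have key : ∀ x, ((((T.drop (x / (h + 1) * (h + 1))).take (2 * h)).drop (x % (h + 1))).take h) =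
      (suffixFrom T x).take h := by
    intro x
    have hxo : x % (h + 1) < h + 1 := Nat.mod_lt _ (by omega)
    rw [List.drop_take, List.take_take, List.drop_drop, Nat.div_add_mod', suffixFrom,
      min_eq_left (by omega)]
  have hl := Den.load (hM 2 (by omega)) (((((((blk hp hpn).mul hB).add (off hp hpn)).mul hE).add
    (blk hq hqn)).mul hB).add (off hq hqn)) (by
      refine (mul_add_lt_mul (mul_add_lt_mul (mul_add_lt_mul hpc hpo) hqc) hqo).trans_eq ?_
      simp only [arrayLength]
      ring)
  simp only [TextIndex.entry, ← hh, ← hEd] at hl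
  rw [mul_add_div_of_lt hqo, mul_add_mod_of_lt hqo, mul_add_div_of_lt hqc, mul_add_mod_of_lt hqc,
    mul_add_div_of_lt hpo, mul_add_mod_of_lt hpo, I.dec_code _ (List.length_take_le _ _),
    I.dec_code _ (List.length_take_le _ _), key, key, length_lcp_take] at hl
  exact hl

theorem den_shift {p q : ℕ} {ep eq : Expr} (hp : Den M args ep p) (hq : Den M args eq q)
    (hpn : p ≤ T.length) (hqn : q ≤ T.length) :
    Den M args (shift ep eq) (I.shift (p % m ^ 2) (q % m ^ 2)) := by
  have hs := G.s_le
  have hms := G.m_sq_le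
  have hm0 := G.m_pos
  have hM0 : 0 < m ^ 2 := by positivity
  have h4 : Den M args (param 4) (m ^ 2) :=
    den_param (j := 4) (hM 0 (by omega)) rfl (by simp [arrayLength])
  have hqo : q % m ^ 2 < m ^ 2 := Nat.mod_lt _ hM0
  have hl := Den.load (hM 3 (by omega)) (((hp.mod h4 (by omega) (by omega)).mul h4).add
    (hq.mod h4 (by omega) (by omega))) (by
      refine (mul_add_lt_mul (Nat.mod_lt _ hM0) hqo).trans_eq ?_
      simp only [arrayLength]
      ring)
  simp only [TextIndex.entry] at hl
  rw [mul_add_div_of_lt hqo, mul_add_mod_of_lt hqo] at hl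
  exact hl

theorem den_rankMultiple {p : ℕ} {ep : Expr} (hp : Den M args ep p) (hpn : p ≤ T.length)
    (hmp : m ∣ p) : Den M args (rankMultiple ep) (I.rank p) := by
  have hs := G.s_le
  have hms := G.m_le
  have h5 : Den M args (param 5) m :=
    den_param (j := 5) (hM 0 (by omega)) rfl (by simp [arrayLength])
  have hl := Den.load (hM 4 (by omega)) (hp.div h5 (by omega) (by omega))
    (Nat.lt_succ_of_le (Nat.div_le_div_right hpn))
  simp only [TextIndex.entry, Nat.div_mul_cancel hmp] at hl
  exact hl

theorem den_rankResidue {q : ℕ} {eq : Expr} (hq : Den M args eq q) (hqn : q ≤ T.length)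
    (hmq : q % m ^ 2 < m) : Den M args (rankResidue eq) (I.rank q) := by
  have hs := G.s_le
  have hms := G.m_le
  have hms2 := G.m_sq_le
  have h4 : Den M args (param 4) (m ^ 2) :=
    den_param (j := 4) (hM 0 (by omega)) rfl (by simp [arrayLength])
  have h5 : Den M args (param 5) m :=
    den_param (j := 5) (hM 0 (by omega)) rfl (by simp [arrayLength])
  have hl := Den.load (hM 5 (by omega)) (((hq.div h4 (by omega) (by omega)).mul h5).add
    (hq.mod h4 (by omega) (by omega)))
    (mul_add_lt_mul (Nat.lt_succ_of_le (Nat.div_le_div_right hqn)) hmq)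
  simp only [TextIndex.entry, mul_add_div_of_lt hmq, mul_add_mod_of_lt hmq, Nat.div_add_mod']
    at hl
  exact hl

theorem den_sameBlock {lo hi : ℕ} {elo ehi : Expr} (hlo : Den M args elo lo)
    (hhi : Den M args ehi hi) (h : lo < hi) (hN : hi < (samples T.length m).card)
    (hb : lo / b = hi / b) : Den M args (sameBlock elo ehi) (I.rankLcp lo hi) := by
  have hs := G.s_le
  have hbs := G.b_le
  have hb0 : 0 < b := by have := G.two_le_b; omega
  have hNn := samples_card_le_succ T.length m
  have h6 : Den M args (param 6) b :=
    den_param (j := 6) (hM 0 (by omega)) rfl (by simp [arrayLength])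
  obtain ⟨h1, h2, h3⟩ := query_within_block I.rankLcp_eq_min hb0 h hb
  have hlb : lo % b < b := Nat.mod_lt _ hb0
  have hj := Den.load (hM 10 (by omega)) (((Den.load (hM 9 (by omega)) hhi hN).mul h6).add
    (hlo.mod h6 (by omega) (by omega))) (mul_add_lt_mul (I.maskCode_lt _) hlb)
  simp only [TextIndex.entry] at hj
  rw [mul_add_div_of_lt hlb, mul_add_mod_of_lt hlb,
    I.maskDec_maskCode _ (show attained I.rankLcp b hi ⊆ _ from Finset.filter_subset _ _)] at hj
  have hl := Den.load (hM 8 (by omega)) (((hlo.div h6 (by omega) (by omega)).mul h6).add hj)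
    (h2.trans hN)
  rw [h3]
  exact hl

/-- Logarithms come from tables, as the machine has no such operation. Level `64 * x + t` is row `x`
of array `32 + t`. -/
theorem den_blockLevel {d u : ℕ} {ed eu : Expr} (hd : Den M args ed d) (hu : Den M args eu u)
    (hdN : d < (samples T.length m).card / b + 2) (huN : u < (samples T.length m).card / b + 1) :
    Den M args (blockLevel ed eu)
      (I.rankLcp ((u + 1) * b) ((u + 2 ^ Nat.log 2 d) * b)) := by
  have hs := G.s_le
  have h64 := G.s_ge
  have hNn := samples_card_le_succ T.length m
  have hNb : (samples T.length m).card / b ≤ (samples T.length m).card / 2 :=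
    Nat.div_le_div_left G.two_le_b two_pos
  have ht := Den.load (hM 11 (by omega)) hd hdN
  have ha := (Den.load (hM 12 (by omega)) hd hdN).add hu
  simp only [TextIndex.entry] at ht ha
  have hmod : Nat.log 2 d % 64 < 64 := Nat.mod_lt _ (by omega)
  have hlog : Nat.log 2 d / 64 < Nat.log 2 T.length / 64 + 1 :=
    Nat.lt_succ_of_le (Nat.div_le_div_right (Nat.log_mono_right (by omega)))
  have hl := Den.loadFrom (hM (32 + Nat.log 2 d % 64) (by omega)) ht (by omega) ha (by
    rw [TextIndex.arrayLength_levels]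
    exact mul_add_lt_mul hlog huN) 64 0 (by omega) (by omega)
  rw [TextIndex.entry_levels] at hl
  simp only [mul_add_div_of_lt huN, mul_add_mod_of_lt huN, Nat.div_add_mod'] at hl
  exact hl

theorem den_otherBlock {lo hi : ℕ} {elo ehi : Expr} (hlo : Den M args elo lo)
    (hhi : Den M args ehi hi) (h : lo < hi) (hN : hi < (samples T.length m).card)
    (hb : lo / b < hi / b) : Den M args (otherBlock elo ehi) (I.rankLcp lo hi) := by
  have hs := G.s_le
  have hbs := G.b_le
  have hb0 : 0 < b := by have := G.two_le_b; omega
  have hNn := samples_card_le_succ T.length m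
  have h6 : Den M args (param 6) b :=
    den_param (j := 6) (hM 0 (by omega)) rfl (by simp [arrayLength])
  have hu := hlo.div h6 (by omega) (by omega)
  have hv := hhi.div h6 (by omega) (by omega)
  have hvN : hi / b ≤ (samples T.length m).card / b := Nat.div_le_div_right hN.le
  have hlu : lo ≤ (lo / b + 1) * b := by
    rw [mul_comm]; exact (Nat.lt_mul_div_succ lo hb0).le
  have hvh : hi / b * b ≤ hi := Nat.div_mul_le_self hi b
  obtain ⟨u, hue⟩ : ∃ u, u = lo / b := ⟨_, rfl⟩
  obtain ⟨v, hve⟩ : ∃ v, v = hi / b := ⟨_, rfl⟩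
  obtain ⟨K, hK⟩ : ∃ K, K = (samples T.length m).card / b := ⟨_, rfl⟩
  rw [← hue] at hu hb hlu
  rw [← hve] at hv hb hvh hvN
  rw [← hK] at hvN
  have hd := hv.sub hu hb.le
  have h1 : 2 ^ Nat.log 2 (v - u) ≤ v - u := Nat.pow_log_le_self 2 (by omega)
  have h2 : v - u < 2 ^ (Nat.log 2 (v - u) + 1) := Nat.lt_pow_succ_log_self one_lt_two _
  have hz := Den.load (hM 13 (by omega)) hd (show v - u < _ / b + 2 by rw [← hK]; omega)
  simp only [TextIndex.entry] at hz
  have hlt : ∀ i k, I.rankLcp i k < 2 ^ w := fun i k => (I.rankLcp_le i k).trans_lt hw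
  have hmin := ((Den.load (hM 6 (by omega)) hlo (h.trans hN)).min
    (Den.load (hM 7 (by omega)) hhi hN) (hlt _ _) (hlt _ _)).min
    ((den_blockLevel G I hM hw hd hu (by omega) (by omega)).min
      (den_blockLevel G I hM hw hd (hv.sub hz (by omega)) (by omega)
        (by omega)) (hlt _ _) (hlt _ _)) ((min_le_left _ _).trans_lt (hlt _ _))
    ((min_le_left _ _).trans_lt (hlt _ _))
  rw [eq_min_of_blocks I.rankLcp_eq_min hlu hvh h1 h2]
  subst hue hve
  exact hmin

theorem den_sortedLcp {lo hi : ℕ} {elo ehi : Expr} (hlo : Den M args elo lo)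
    (hhi : Den M args ehi hi) (h : lo < hi) (hN : hi < (samples T.length m).card) :
    Den M args (sortedLcp elo ehi) (I.rankLcp lo hi) := by
  have hs := G.s_le
  have hbs := G.b_le
  have hNn := samples_card_le_succ T.length m
  have h6 : Den M args (param 6) b :=
    den_param (j := 6) (hM 0 (by omega)) rfl (by simp [arrayLength])
  have h1 : lo / b ≤ lo := Nat.div_le_self _ _
  have h2 : hi / b ≤ hi := Nat.div_le_self _ _
  have h3 : lo / b ≤ hi / b := Nat.div_le_div_right h.le
  exact Den.sel_eq (hlo.div h6 (by omega) (by omega)) (hhi.div h6 (by omega) (by omega))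
    (by omega) (by omega) (fun e => den_sameBlock G I hM hw hlo hhi h hN e)
    (fun e => den_otherBlock G I hM hw hlo hhi h hN (by omega))

theorem den_rankLcp {x y : ℕ} {ex ey : Expr} (hx : Den M args ex x) (hy : Den M args ey y)
    (hxy : x ≠ y) (hxN : x < (samples T.length m).card) (hyN : y < (samples T.length m).card) :
    Den M args (rankLcp ex ey) (I.rankLcp x y) := by
  have hNn := samples_card_le_succ T.length m
  refine Den.sel_lt hx hy (by omega) (by omega)
    (fun h => den_sortedLcp G I hM hw hx hy h hyN) (fun h => ?_)
  rw [TextIndex.rankLcp, lcp_comm]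
  exact den_sortedLcp G I hM hw hy hx (by omega) hxN

theorem den_posLcp {p q : ℕ} {ep eq : Expr} (hp : Den M args ep p) (hq : Den M args eq q)
    (hpn : p ≤ T.length) (hqn : q ≤ T.length) :
    Den M args (posLcp ep eq) (lcp (suffixFrom T p) (suffixFrom T q)).length := by
  have hs := G.s_le
  have hms := G.m_sq_le
  have h1 : Den M args (param 1) T.length :=
    den_param (j := 1) (hM 0 (by omega)) rfl (by simp [arrayLength])
  have h7 : Den M args (param 7) (2 * (m ^ 2 - 1)) :=
    den_param (j := 7) (hM 0 (by omega)) rfl (by simp [arrayLength])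
  -- Equal positions are treated apart: the range minimum needs two different ranks.
  refine Den.sel_eq hp hq (by omega) (by omega) (fun e => ?_) (fun hne => ?_)
  · subst e
    rw [lcp_self, suffixFrom, List.length_drop]
    exact h1.sub hp hpn
  have hwin := den_window G I hM hw hp hq hpn hqn
  refine Den.sel_eq hwin h7 (by omega) (by omega) (fun e => ?_) (fun e => ?_)
  · have hsh := den_shift G I hM hw hp hq hpn hqn
    have hle := I.shift_le (p % m ^ 2) (q % m ^ 2)
    have hdvd := I.dvd_add_shift p q
    have hmod := I.add_shift_mod p q
    set δ := I.shift (p % m ^ 2) (q % m ^ 2)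
    have hδ : δ ≤ (lcp (suffixFrom T p) (suffixFrom T q)).length := by omega
    have hp1 := length_lcp_le_left (suffixFrom T p) (suffixFrom T q)
    have hq1 := length_lcp_le_left (suffixFrom T q) (suffixFrom T p)
    rw [lcp_comm (suffixFrom T q)] at hq1
    simp only [suffixFrom, List.length_drop] at hp1 hq1
    have hpδ : p + δ ≤ T.length := by simp only [suffixFrom] at hδ; omega
    have hqδ : q + δ ≤ T.length := by simp only [suffixFrom] at hδ; omega
    have hpS : p + δ ∈ samples T.length m := by
      simp only [samples, Finset.mem_filter, Finset.mem_range]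
      exact ⟨by omega, .inl hdvd⟩
    have hqS : q + δ ∈ samples T.length m := by
      simp only [samples, Finset.mem_filter, Finset.mem_range]
      exact ⟨by omega, .inr hmod⟩
    -- Equal ranks would give equal suffixes, but suffixes at different positions up to `n` differ
    -- in length.
    have hrne : I.rank (p + δ) ≠ I.rank (q + δ) := by
      intro hr
      have h2 := I.sorted_rank _ hpS
      rw [hr, I.sorted_rank _ hqS] at h2
      have h3 := congrArg List.length h2
      simp only [suffixFrom, List.length_drop] at h3
      omega
    have hr := den_rankLcp G I hM hw
      (den_rankMultiple G I hM hw (hp.add hsh) hpδ hdvd)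
      (den_rankResidue G I hM hw (hq.add hsh) hqδ hmod) hrne (I.rank_lt _ hpS) (I.rank_lt _ hqS)
    rw [TextIndex.rankLcp, I.sorted_rank _ hpS, I.sorted_rank _ hqS] at hr
    rw [length_lcp_drop δ _ _ hδ]
    simp only [suffixFrom, List.drop_drop] at hr ⊢
    exact hsh.add hr
  · have h2 : min (2 * (m ^ 2 - 1)) (lcp (suffixFrom T p) (suffixFrom T q)).length =
        (lcp (suffixFrom T p) (suffixFrom T q)).length := by omega
    rwa [h2] at hwin

end Correctness

/-! ### The data structure -/

open WordRAM WordRAM.Expr in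
theorem exists_memory_of_long {σ m b s w k n₀ : ℕ} {T : List (Fin σ)}
    (G : GoodParams T.length σ m b s) (hw : T.length < 2 ^ w) (hk : 96 ≤ k) :
    ∃ D : Fin k → List (BitVec w), (∀ a, (D a).length ≤ 2 ^ w) ∧
      (∑ a, (D a).length) * m ≤ k * (8 * T.length) ∧
      ∀ f₁ f₂ i : ℕ, f₁ ≤ T.length → f₂ ≤ T.length → i < 2 ^ w →
        ComputesWithin (query n₀).program (memOf D)
          [BitVec.ofNat w f₁, BitVec.ofNat w f₂, BitVec.ofNat w i]
          (lcp (suffixFrom T (f₁ + i)) (suffixFrom T f₂)).length (query n₀).program.length := by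
  obtain ⟨I⟩ := nonempty_textIndex T G.m_pos b
  set len := arrayLength T.length σ m b (samples T.length m).card with hlen
  have hbound := G.arrayLength_le
  refine ⟨fun a => (List.range (len a)).map fun x => BitVec.ofNat w (I.entry a x), ?_, ?_, ?_⟩
  · intro a
    simpa using (hbound a).1.trans hw
  · simp only [List.length_map, List.length_range]
    rw [Finset.sum_mul]
    simpa using Finset.sum_le_card_nsmul Finset.univ (fun a : Fin k => len a * m) (8 * T.length)
      fun a _ => (hbound a).2
  · intro f₁ f₂ i h₁ h₂ hi
    have hM : ∀ a < 96, Holds (memOf fun a : Fin k =>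
        (List.range (len a)).map fun x => BitVec.ofNat w (I.entry a x)) a (len a) (I.entry a) :=
      fun a ha => holds_memOf len I.entry (ha.trans_le hk) ((hbound a).1.trans hw)
    refine computesWithin_program ?_
      (((length_lcp_le_left _ _).trans (length_suffixFrom_le _ _)).trans_lt hw)
    refine Den.sel_one (den_param (hM 0 (by omega)) rfl (by simp [hlen, arrayLength])) ?_
    have hp := den_firstPos (f₂ := f₂) (n := T.length) (hM 0 (by omega)) (by simp [hlen, arrayLength]) rfl hw h₁ hi
    have h := den_posLcp G I hM hw hp (eq := arg 1) (q := f₂) rfl (min_le_right _ _) h₂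
    rwa [suffixFrom_min] at h

-- Array `32 + p` holds the answers for first position `p`, as one array for all pairs could exceed
-- `2 ^ w` entries. The entry 0 in place of the parameter 1 directs the query to these arrays.
open WordRAM WordRAM.Expr in
theorem exists_memory_of_short {σ w k n₀ : ℕ} {T : List (Fin σ)} (h0 : 0 < T.length)
    (hw : T.length < 2 ^ w) (hn : T.length < n₀) (hk : 32 + n₀ ≤ k) :
    ∃ D : Fin k → List (BitVec w), (∀ a, (D a).length ≤ 2 ^ w) ∧
      (∑ a, (D a).length) = k * (T.length + 1) ∧
      ∀ f₁ f₂ i : ℕ, f₁ ≤ T.length → f₂ ≤ T.length → i < 2 ^ w →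
        ComputesWithin (query n₀).program (memOf D)
          [BitVec.ofNat w f₁, BitVec.ofNat w f₂, BitVec.ofNat w i]
          (lcp (suffixFrom T (f₁ + i)) (suffixFrom T f₂)).length (query n₀).program.length := by
  set F : ℕ → ℕ → ℕ := fun a x => if a = 0 then [0, T.length].getD x 0 else
    (lcp (suffixFrom T (a - 32)) (suffixFrom T x)).length with hF
  set len : ℕ → ℕ := fun _ => T.length + 1 with hlen
  refine ⟨fun a => (List.range (len a)).map fun x => BitVec.ofNat w (F a x), ?_, ?_, ?_⟩
  · intro a
    simpa [hlen] using hw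
  · simp [hlen]
  · intro f₁ f₂ i h₁ h₂ hi
    have hM : ∀ a < k, Holds (memOf fun a : Fin k =>
        (List.range (len a)).map fun x => BitVec.ofNat w (F a x)) a (len a) (F a) :=
      fun a ha => holds_memOf len F ha hw
    refine computesWithin_program ?_
      (((length_lcp_le_left _ _).trans (length_suffixFrom_le _ _)).trans_lt hw)
    refine Den.sel_zero (den_param (hM 0 (by omega)) rfl (by simp [hlen])) ?_
    have hp := den_firstPos (f₂ := f₂) (n := T.length) (hM 0 (by omega)) (by simp [hlen, h0]) rfl hw h₁ hi
    have hle : min (f₁ + i) T.length ≤ T.length := min_le_right _ _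
    have h := Den.loadFrom (m := 32) (hM (32 + min (f₁ + i) T.length) (by omega)) hp (by omega)
      (f := arg 1) (a := f₂) rfl (Nat.lt_succ_of_le h₂) n₀ 0 (by omega) (by omega)
    simpa [hF, suffixFrom_min] using h

theorem mainTheorem5 (c₁ c₂ κ : ℝ) (hc₁ : 0 < c₁) (hc₂ : c₁ ≤ c₂) (hκ : 0 < κ) :
    ∃ (P : WordRAM.Program) (k c : ℕ) (C : ℝ),
      ∀ (σ r w : ℕ) (T : List (Fin σ)),
        2 ≤ σ → σ ≤ T.length →
        c₁ * √(Real.logb σ T.length) ≤ r → (r : ℝ) ≤ c₂ * √(Real.logb σ T.length) →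
        blockLength r ∣ T.length →
        T.length < 2 ^ w → (w : ℝ) ≤ κ * Real.logb 2 T.length →
        ∃ D : Fin k → List (BitVec w),
          (∀ m, (D m).length ≤ 2 ^ w) ∧
          ((∑ m, (D m).length : ℕ) : ℝ) * w ≤
            C * (T.length * √(Real.logb 2 T.length * Real.logb 2 σ)) ∧
          ∀ f₁ f₂ i : ℕ, IsSelected T.length r f₁ → IsSelected T.length r f₂ →
            1 ≤ i → i ≤ 4 * r + 3 →
            WordRAM.ComputesWithin P (WordRAM.memOf D)
              [BitVec.ofNat w f₁, BitVec.ofNat w f₂, BitVec.ofNat w i]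
              (lcp (suffixFrom T (f₁ + i)) (suffixFrom T f₂)).length c := by
  obtain ⟨n₀, hn₀⟩ : ∃ n₀, n₀ = 2 ^ 128 := ⟨_, rfl⟩
  -- The two summands of `C` pay for long and for short texts; `160 = 20 * 8` combines `sqrt_log`
  -- with the bound `8 * n` on each array length times `m`.
  refine ⟨(WordRAM.Expr.query n₀).program, 96 + n₀, (WordRAM.Expr.query n₀).program.length,
    160 * (96 + n₀ : ℕ) * κ + 2 * (96 + n₀ : ℕ) * κ * n₀, ?_⟩
  intro σ r w T hσ hσn _ _ hdvd hw hwκ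
  have hn2 : 2 ≤ T.length := hσ.trans hσn
  have hi : ∀ i, i ≤ 4 * r + 3 → i < 2 ^ w := fun i hi => by
    have h1 : blockLength r ≤ T.length := Nat.le_of_dvd (by omega) hdvd
    have h2 : 4 * r + 3 < blockLength r := by unfold blockLength; nlinarith
    omega
  have hτ : 1 ≤ Real.logb 2 σ := by
    rw [Real.le_logb_iff_rpow_le one_lt_two (by positivity)]
    simpa using hσ
  have hl : 1 ≤ Real.logb 2 T.length := by
    rw [Real.le_logb_iff_rpow_le one_lt_two (by positivity)]
    simpa using hn2
  have hroot : 1 ≤ √(Real.logb 2 T.length * Real.logb 2 σ) := by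
    rw [Real.one_le_sqrt]; nlinarith
  set k := 96 + n₀ with hk
  have hk0 : (0 : ℝ) < k := by positivity
  rcases lt_or_ge T.length n₀ with hn | hn
  · obtain ⟨D, h1, h2, h3⟩ := exists_memory_of_short (k := k) (by omega) hw hn (by omega)
    refine ⟨D, h1, ?_, fun f₁ f₂ i hf₁ hf₂ _ hi' => h3 f₁ f₂ i hf₁.le hf₂.le (hi i hi')⟩
    rw [h2]
    have h4 : Real.logb 2 T.length ≤ n₀ := by
      rw [Real.logb_le_iff_le_rpow one_lt_two (by positivity)]
      exact_mod_cast (hn.trans Nat.lt_two_pow_self).le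
    have h5 : (T.length : ℝ) + 1 ≤ 2 * T.length := by
      have : (2 : ℝ) ≤ T.length := by exact_mod_cast hn2
      linarith
    set X := √(Real.logb 2 T.length * Real.logb 2 σ)
    calc ((k * (T.length + 1) : ℕ) : ℝ) * w
        ≤ (k * (2 * T.length)) * (κ * n₀) := by
          push_cast
          gcongr
          exact hwκ.trans (by gcongr)
      _ = 2 * k * κ * n₀ * (T.length * 1) := by ring
      _ ≤ 2 * k * κ * n₀ * (T.length * X) := by gcongr
      _ ≤ _ := by
          gcongr
          have : 0 ≤ 160 * k * κ := by positivity
          linarith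
  · have hlog : 128 ≤ Nat.log 2 T.length :=
      (Nat.le_log_iff_pow_le one_lt_two (by omega)).2 (hn₀ ▸ hn)
    obtain ⟨m, b, s, G⟩ := exists_goodParams hlog hσ
    obtain ⟨D, h1, h2, h3⟩ := exists_memory_of_long (k := k) (n₀ := n₀) G hw (by omega)
    refine ⟨D, h1, ?_, fun f₁ f₂ i hf₁ hf₂ _ hi' => h3 f₁ f₂ i hf₁.le hf₂.le (hi i hi')⟩
    have hm := G.m_pos
    have hroots := G.sqrt_log
    have h2' : ((∑ a, (D a).length : ℕ) : ℝ) * m ≤ k * (8 * T.length) := by exact_mod_cast h2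
    set S := ((∑ a, (D a).length : ℕ) : ℝ)
    have hS : 0 ≤ S := Nat.cast_nonneg _
    rw [Real.sqrt_mul (by linarith)] at hroot ⊢
    have hsq : Real.logb 2 T.length = √(Real.logb 2 T.length) * √(Real.logb 2 T.length) :=
      (Real.mul_self_sqrt (by linarith)).symm
    set x := √(Real.logb 2 T.length)
    set y := √(Real.logb 2 σ)
    have hx : 0 ≤ x := Real.sqrt_nonneg _
    have hy : 0 ≤ y := Real.sqrt_nonneg _
    -- One of the two factors `√(log n)` is traded for `20 * m * √(log σ)`, and this `m` is absorbed
    -- by the bound on `S * m`.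
    calc S * w ≤ S * (κ * (x * x)) := by rw [hsq] at hwκ; gcongr
      _ ≤ S * (κ * (x * (20 * m * y))) := by gcongr
      _ = 20 * (S * m) * (κ * (x * y)) := by ring
      _ ≤ 20 * (k * (8 * T.length)) * (κ * (x * y)) := by gcongr
      _ = 160 * k * κ * (T.length * (x * y)) := by ring
      _ ≤ _ := by
          gcongr
          have : 0 ≤ 2 * k * κ * n₀ := by positivity
          linarith
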